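/- **Transseries.** For a totally ordered abelian (multiplicative) group $(\mathcal G,\cdot,\ll)$ of monomials, let $S(\mathcal G)$ be the algebra of finitely generated formal series $$\sum_{\mathbf k\ge \mathbf k_0}c_{\mathbf k}\,\mu_1^{k_1}\cdots\mu_M^{k_M},\qquad M\in\mathbb N,\ \mu_1,\dots,\mu_M\in\mathcal G,\ \mu_i\ll 1,\ \mathbf k_0\in\mathbb Z^M,\ c_{\mathbf k}\in\mathbb R,$$ where two such sums are identified if every monomial has the same total coefficient in both. For $T\ne0$ in $S(\mathcal G)$, $\mathrm{mag}(T)$ is the $\ll$-largest monomial with nonzero coefficient in $T$, and $\mathrm{mag}(0)=0$, with $0\ll\mu$ for every monomial $\mu$. Write $T_1\gg T_2$ iff $\mathrm{mag}(T_1)\gg\mathrm{mag}(T_2)$ (so $T\gg 0$ iff $T\neq 0$, and $0\gg T$ never holds), and $T_1>T_2$ iff the coefficient of $\mathrm{mag}(T_1-T_2)$ in $T_1-T_2\ne 0$ is positive. $T$ is *large* if all monomials with nonzero coefficient in $T$ are $\gg1$, and *small* if they are all $\ll1$ (both allow $T=0$). Let $\mathcal G^{[0]}=\{x^\sigma:\sigma\in\mathbb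 R\}$, with $x^{\sigma_1}\gg x^{\sigma_2}$ iff $\sigma_1>\sigma_2$, let $\mathcal T^{[n]}=S(\mathcal G^{[n]})$, and let $\mathcal G^{[n+1]}$ be the group of formal expressions $x^{\sigma}e^{L}$, with $\sigma\in\mathbb R$ and $L\in\mathcal T^{[n]}$ large (or zero), with $x^{\sigma_1}e^{L_1}\cdot x^{\sigma_2}e^{L_2}=x^{\sigma_1+\sigma_2}e^{L_1+L_2}$ and $$x^{\sigma_1}e^{L_1}\gg x^{\sigma_2}e^{L_2}\iff L_1>L_2\ \text{ or }\ (L_1=L_2\text{ and }\sigma_1>\sigma_2).$$ With the natural embeddings $\mathcal T^{[n]}\subset\mathcal T^{[n+1]}$, the space of (log-free) transseries is $\mathcal T=\bigcup_n\mathcal T^{[n]}$. Differentiation $T\mapsto T'=\mathcal D T$ on $\mathcal T$ is defined inductively, term by term, from $\mathcal D(x^\sigma e^{L})=\sigma x^{\sigma-1}e^{L}+x^{\sigma}L'e^{L}$. **Proposition.** Let $L_1,L_2\in\mathcal T$ be large transseries and $S_1,S_2\in\mathcal T$ small transseries. Then $$L_1\gg L_2\iff L_1'\gg L_2',\qquad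 S_1\gg S_2\iff S_1'\gg S_2',$$ and, if $L_1\neq 0$, $$L_1'\gg S_1'.$$ Moreover, for every $T\in\mathcal T$: $\mathcal D T=0$ if and only if $T$ is a (real) constant. -/

import Mathlib

noncomputable section

open scoped HahnSeries Pointwise

namespace LogFree

/-! ## Finitely generated series over a totally ordered abelian group

Groups of monomials are written additively, through exponents, as is usual for Hahn series: an
exponent `γ : Γ` stands for a formal monomial `t ^ γ`, and `t ^ γ ≫ t ^ δ` means `γ < δ`.
So a monomial is `≪ 1` iff its exponent is positive, and `≫ 1` iff its exponent is negative. -/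

section FinGen

set_option linter.unusedSectionVars false

variable {Γ Γ' : Type} [AddCommGroup Γ] [LinearOrder Γ] [IsOrderedAddMonoid Γ]
  [AddCommGroup Γ'] [LinearOrder Γ'] [IsOrderedAddMonoid Γ']

/-- The exponents of the monomials `μ ^ k = μ₁ ^ k₁ ⋯ μ_M ^ k_M` with `k ∈ ℤ ^ M` and `k ≥ k₀`. -/
def cone {ι : Type} [Fintype ι] (μ : ι → Γ) (k₀ : ι → ℤ) : Set Γ :=
  {γ | ∃ k : ι → ℤ, k₀ ≤ k ∧ γ = ∑ i, k i • μ i}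

/-- A set of monomials all of which have the form `μ ^ k`, `k ≥ k₀`, for finitely many
generating monomials `μ₁, …, μ_M ≪ 1` and some `k₀ ∈ ℤ ^ M`. -/
def FinGen (A : Set Γ) : Prop :=
  ∃ (M : ℕ) (μ : Fin M → Γ) (k₀ : Fin M → ℤ), (∀ i, 0 < μ i) ∧ A ⊆ cone μ k₀

theorem FinGen.of_fintype {ι : Type} [Fintype ι] (μ : ι → Γ) (k₀ : ι → ℤ) (hμ : ∀ i, 0 < μ i)
    {A : Set Γ} (hA : A ⊆ cone μ k₀) : FinGen A := by
  let e := Fintype.equivFin ι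
  refine ⟨Fintype.card ι, μ ∘ e.symm, k₀ ∘ e.symm, fun i => hμ _, fun γ hγ => ?_⟩
  obtain ⟨k, hk, rfl⟩ := hA hγ
  exact ⟨k ∘ e.symm, fun i => hk _,
    (Equiv.sum_comp e.symm (fun i => k i • μ i)).symm⟩

theorem FinGen.mono {A B : Set Γ} (hB : FinGen B) (h : A ⊆ B) : FinGen A := by
  obtain ⟨M, μ, k₀, hμ, hA⟩ := hB
  exact ⟨M, μ, k₀, hμ, h.trans hA⟩

theorem FinGen.common {A B : Set Γ} (hA : FinGen A) (hB : FinGen B) :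
    ∃ (ι : Type) (_ : Fintype ι) (μ : ι → Γ) (k₀ : ι → ℤ), (∀ i, 0 < μ i) ∧
      A ⊆ cone μ k₀ ∧ B ⊆ cone μ k₀ := by
  obtain ⟨M, μ, k₀, hμ, hA⟩ := hA
  obtain ⟨N, ν, l₀, hν, hB⟩ := hB
  refine ⟨Fin M ⊕ Fin N, inferInstance, Sum.elim μ ν,
    Sum.elim (fun i => min (k₀ i) 0) (fun i => min (l₀ i) 0), ?_, ?_, ?_⟩
  · rintro (i | i)
    · exact hμ i
    · exact hν i
  · intro γ hγ
    obtain ⟨k, hk, rfl⟩ := hA hγ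
    refine ⟨Sum.elim k 0, ?_, by simp⟩
    rintro (i | i)
    · exact (min_le_left _ _).trans (hk i)
    · exact min_le_right _ _
  · intro γ hγ
    obtain ⟨k, hk, rfl⟩ := hB hγ
    refine ⟨Sum.elim 0 k, ?_, by simp⟩
    rintro (i | i)
    · exact min_le_right _ _
    · exact (min_le_left _ _).trans (hk i)

theorem FinGen.union {A B : Set Γ} (hA : FinGen A) (hB : FinGen B) : FinGen (A ∪ B) := by
  obtain ⟨ι, _, μ, k₀, hμ, h₁, h₂⟩ := hA.common hB
  exact FinGen.of_fintype μ k₀ hμ (Set.union_subset h₁ h₂)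

theorem FinGen.add {A B : Set Γ} (hA : FinGen A) (hB : FinGen B) : FinGen (A + B) := by
  obtain ⟨ι, _, μ, k₀, hμ, h₁, h₂⟩ := hA.common hB
  refine FinGen.of_fintype μ (k₀ + k₀) hμ ?_
  rintro _ ⟨a, ha, b, hb, rfl⟩
  obtain ⟨k, hk, rfl⟩ := h₁ ha
  obtain ⟨l, hl, rfl⟩ := h₂ hb
  exact ⟨k + l, add_le_add hk hl, by simp [add_smul, Finset.sum_add_distrib]⟩

theorem FinGen.empty : FinGen (∅ : Set Γ) :=
  ⟨0, Fin.elim0, Fin.elim0, fun i => i.elim0, Set.empty_subset _⟩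

theorem FinGen.biUnion {ι : Type} (s : Finset ι) (A : ι → Set Γ) (h : ∀ i, FinGen (A i)) :
    FinGen (⋃ i ∈ s, A i) := by
  classical
  induction s using Finset.induction_on with
  | empty => simpa using FinGen.empty
  | insert a s ha ih =>
    rw [Finset.set_biUnion_insert]
    exact (h a).union ih

theorem FinGen.singleton (γ : Γ) : FinGen {γ} := by
  have key : ∀ (μ : Γ) (n : ℤ), 0 < μ → FinGen {n • μ} := fun μ n hμ =>
    ⟨1, fun _ => μ, fun _ => n, fun _ => hμ, by
      rintro _ rfl
      exact ⟨fun _ => n, le_rfl, by simp⟩⟩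
  rcases lt_trichotomy γ 0 with h | rfl | h
  · simpa using key (-γ) (-1) (by simpa using h)
  · exact ⟨0, Fin.elim0, Fin.elim0, fun i => i.elim0, by
      rintro _ rfl
      exact ⟨Fin.elim0, fun i => i.elim0, by simp⟩⟩
  · simpa using key γ 1 h

theorem FinGen.image {A : Set Γ} (hA : FinGen A) (f : Γ →+ Γ') (hf : StrictMono f) :
    FinGen (f '' A) := by
  obtain ⟨M, μ, k₀, hμ, hA⟩ := hA
  refine ⟨M, f ∘ μ, k₀, fun i => by simpa using hf (hμ i), ?_⟩
  rintro _ ⟨γ, hγ, rfl⟩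
  obtain ⟨k, hk, rfl⟩ := hA hγ
  exact ⟨k, hk, by simp⟩

variable (Γ) in
/-- The algebra of finitely generated formal series `∑_{k ≥ k₀} c_k μ ^ k` with real coefficients
over the ordered group `Γ` of monomials. A formal sum is identified with the function sending a
monomial to its total coefficient; the support of such a function is automatically well ordered,
so it is a Hahn series. -/
def serAlgebra : Subalgebra ℝ ℝ⟦Γ⟧ where
  carrier := {f | FinGen f.support}
  mul_mem' ha hb := (ha.add hb).mono HahnSeries.support_mul_subset
  add_mem' ha hb := (ha.union hb).mono (HahnSeries.support_add_subset _ _)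
  algebraMap_mem' _ := (FinGen.singleton (0 : Γ)).mono HahnSeries.support_single_subset

variable (Γ) in
/-- The algebra of finitely generated formal series, as a type. -/
def Ser : Type := serAlgebra Γ

instance : CommRing (Ser Γ) := inferInstanceAs (CommRing (serAlgebra Γ))

instance : Algebra ℝ (Ser Γ) := inferInstanceAs (Algebra ℝ (serAlgebra Γ))

/-- The underlying Hahn series. -/
def Ser.toHahn : Ser Γ →ₐ[ℝ] ℝ⟦Γ⟧ := (serAlgebra Γ).val

theorem Ser.finGen (f : Ser Γ) : FinGen f.toHahn.support := f.2

theorem Ser.ext {f g : Ser Γ} (h : f.toHahn = g.toHahn) : f = g := Subtype.ext h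

/-- The monomial series `c t ^ γ`. -/
def mono (γ : Γ) (c : ℝ) : Ser Γ :=
  ⟨HahnSeries.single γ c, (FinGen.singleton γ).mono HahnSeries.support_single_subset⟩

@[simp] theorem toHahn_mono (γ : Γ) (c : ℝ) : (mono γ c).toHahn = HahnSeries.single γ c := rfl

/-- A series is large if all its monomials are `≫ 1` (this allows the zero series). -/
def IsLargeSer (f : Ser Γ) : Prop := ∀ γ, f.toHahn.coeff γ ≠ 0 → γ < 0

/-- A series is small if all its monomials are `≪ 1` (this allows the zero series). -/
def IsSmallSer (f : Ser Γ) : Prop := ∀ γ, f.toHahn.coeff γ ≠ 0 → 0 < γ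

/-- `f ≫ g`, i.e. `mag f ≫ mag g`. The exponent of the dominant monomial of `f` is `f.orderTop`,
which is `⊤` iff `f = 0`; thus `mag 0 = 0`, and `f ≫ 0` iff `f ≠ 0`. -/
def DomSer (f g : Ser Γ) : Prop := f.toHahn.orderTop < g.toHahn.orderTop

variable (Γ) in
/-- The additive group of large series. -/
def largeSubgroup : AddSubgroup (Ser Γ) where
  carrier := {f | IsLargeSer f}
  add_mem' := fun {a b} ha hb γ h => by
    by_cases h' : a.toHahn.coeff γ = 0
    · exact hb γ fun h'' => h (by simp [h', h''])
    · exact ha γ h'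
  zero_mem' := fun γ h => by simp at h
  neg_mem' := fun {a} ha γ h => ha γ (by simpa using h)

variable (Γ) in
/-- The additive group of large series, as a type. -/
def Large : Type := largeSubgroup Γ

instance : AddCommGroup (Large Γ) := inferInstanceAs (AddCommGroup (largeSubgroup Γ))

/-- The underlying series of a large series. -/
def Large.toSer : Large Γ →+ Ser Γ := (largeSubgroup Γ).subtype

theorem Large.toSer_injective : Function.Injective (Large.toSer (Γ := Γ)) :=
  Subtype.val_injective

theorem Large.isLargeSer (L : Large Γ) : IsLargeSer L.toSer := L.2

/-- The order on large series: `L₁ < L₂` iff the leading coefficient of `L₂ - L₁` is positive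
(see `Large.lt_iff`). -/
instance : LinearOrder (Large Γ) :=
  LinearOrder.lift' (fun L : Large Γ => toLex L.toSer.toHahn) fun _ _ h =>
    Large.toSer_injective (Ser.ext (toLex.injective h))

theorem Large.lt_iff (L₁ L₂ : Large Γ) :
    L₁ < L₂ ↔ 0 < (L₂.toSer.toHahn - L₁.toSer.toHahn).leadingCoeff := by
  rw [← ofLex_toLex (L₂.toSer.toHahn - L₁.toSer.toHahn), HahnSeries.leadingCoeff_pos_iff, toLex_sub, sub_pos]
  rfl

instance : IsOrderedAddMonoid (Large Γ) where
  add_le_add_left a b h c := by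
    change toLex (a.toSer.toHahn + c.toSer.toHahn) ≤ toLex (b.toSer.toHahn + c.toSer.toHahn)
    have h' : toLex a.toSer.toHahn ≤ toLex b.toSer.toHahn := h
    rw [toLex_add, toLex_add]
    gcongr

/-! ## The next group of monomials -/

variable (Γ) in
/-- The group of transmonomials `x ^ σ exp L` with `σ : ℝ` and `L` zero or a large series over `Γ`.
The exponent `Mon.mk L σ` stands for the transmonomial `x ^ (-σ) exp (-L)`; with this sign
the lexicographic order of exponents is the order of transmonomials, according to the convention
that larger monomials have smaller exponents:
`x ^ (-σ₁) exp (-L₁) ≫ x ^ (-σ₂) exp (-L₂)` iff `-L₁ > -L₂`, or `-L₁ = -L₂` and `-σ₁ > -σ₂`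
(see `Mon.lt_iff`). -/
def Mon : Type := Lex (Large Γ × ℝ)

instance : AddCommGroup (Mon Γ) := inferInstanceAs (AddCommGroup (Lex (Large Γ × ℝ)))

instance : LinearOrder (Mon Γ) := inferInstanceAs (LinearOrder (Lex (Large Γ × ℝ)))

instance : IsOrderedAddMonoid (Mon Γ) := inferInstanceAs (IsOrderedAddMonoid (Lex (Large Γ × ℝ)))

/-- The exponent of the transmonomial `x ^ (-σ) exp (-L)`. -/
def Mon.mk (L : Large Γ) (σ : ℝ) : Mon Γ := toLex (L, σ)

/-- The `L` of the transmonomial `x ^ (-σ) exp (-L)`. -/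
def Mon.large : Mon Γ →+ Large Γ where
  toFun γ := (ofLex (α := Large Γ × ℝ) γ).1
  map_zero' := rfl
  map_add' _ _ := rfl

/-- The `σ` of the transmonomial `x ^ (-σ) exp (-L)`. -/
def Mon.pow : Mon Γ →+ ℝ where
  toFun γ := (ofLex (α := Large Γ × ℝ) γ).2
  map_zero' := rfl
  map_add' _ _ := rfl

@[simp] theorem Mon.large_mk (L : Large Γ) (σ : ℝ) : (Mon.mk L σ).large = L := rfl

@[simp] theorem Mon.pow_mk (L : Large Γ) (σ : ℝ) : (Mon.mk L σ).pow = σ := rfl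

theorem Mon.ext {a b : Mon Γ} (h₁ : a.large = b.large) (h₂ : a.pow = b.pow) : a = b :=
  congrArg toLex (Prod.ext h₁ h₂)

theorem Mon.lt_iff (a b : Mon Γ) :
    a < b ↔ a.large < b.large ∨ a.large = b.large ∧ a.pow < b.pow :=
  Prod.Lex.lt_iff

/-- The map on series that is induced by a strictly monotone homomorphism of monomial groups. -/
def emb (ι : Γ →+ Γ') (hι : StrictMono ι) : Ser Γ →ₐ[ℝ] Ser Γ' :=
  AlgHom.codRestrict ((HahnSeries.embDomainAlgHom (R := ℝ) ι hι.injective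
      (fun _ _ => hι.le_iff_le)).comp Ser.toHahn) (serAlgebra Γ') fun f =>
    (FinGen.image f.finGen ι hι).mono HahnSeries.support_embDomain_subset

theorem emb_coeff (ι : Γ →+ Γ') (hι : StrictMono ι) (f : Ser Γ) (γ : Γ) :
    (emb ι hι f).toHahn.coeff (ι γ) = f.toHahn.coeff γ :=
  HahnSeries.embDomain_mk_coeff hι.injective _

theorem emb_coeff_of_notMem (ι : Γ →+ Γ') (hι : StrictMono ι) (f : Ser Γ) {γ : Γ'}
    (h : γ ∉ Set.range ι) : (emb ι hι f).toHahn.coeff γ = 0 :=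
  HahnSeries.embDomain_of_notMem_range h

theorem emb_mono (ι : Γ →+ Γ') (hι : StrictMono ι) (γ : Γ) (c : ℝ) :
    emb ι hι (mono γ c) = mono (ι γ) c :=
  Ser.ext HahnSeries.embDomain_single

/-- The map induced on large series. -/
def Large.map (ι : Γ →+ Γ') (hι : StrictMono ι) : Large Γ →+ Large Γ' where
  toFun L := ⟨emb ι hι L.toSer, fun γ h => by
    by_cases hγ : γ ∈ Set.range ι
    · obtain ⟨γ, rfl⟩ := hγ
      rw [emb_coeff] at h
      simpa using hι (L.isLargeSer γ h)
    · exact absurd (emb_coeff_of_notMem ι hι _ hγ) h⟩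
  map_zero' := Subtype.ext (map_zero (emb ι hι))
  map_add' a b := Subtype.ext (map_add (emb ι hι) a.toSer b.toSer)

theorem Large.toSer_map (ι : Γ →+ Γ') (hι : StrictMono ι) (L : Large Γ) :
    (Large.map ι hι L).toSer = emb ι hι L.toSer := rfl

theorem Large.map_strictMono (ι : Γ →+ Γ') (hι : StrictMono ι) : StrictMono (Large.map ι hι) := by
  intro a b h
  have h' : toLex a.toSer.toHahn < toLex b.toSer.toHahn := h
  exact (HahnSeries.embDomainOrderEmbedding (R := ℝ)
    (⟨⟨ι, hι.injective⟩, hι.le_iff_le⟩ : Γ ↪o Γ')).strictMono h'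

/-- The map induced on transmonomials: `x ^ (-σ) exp (-L) ↦ x ^ (-σ) exp (-L)`, where on the right
`L` is regarded as a series over `Γ'`. -/
def Mon.map (ι : Γ →+ Γ') (hι : StrictMono ι) : Mon Γ →+ Mon Γ' where
  toFun γ := Mon.mk (Large.map ι hι γ.large) γ.pow
  map_zero' := Mon.ext (by simp) (by simp)
  map_add' a b := Mon.ext (by simp) (by simp)

theorem Mon.map_strictMono (ι : Γ →+ Γ') (hι : StrictMono ι) : StrictMono (Mon.map ι hι) := by
  intro a b h
  rw [Mon.lt_iff] at h ⊢
  rcases h with h | ⟨h, h'⟩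
  · exact Or.inl (Large.map_strictMono ι hι h)
  · exact Or.inr ⟨congrArg (Large.map ι hι) h, h'⟩

/-! ## Term by term differentiation

`dlog γ` is the logarithmic derivative of the monomial `t ^ γ`, so `D (t ^ γ) = t ^ γ * dlog γ`. -/

theorem exists_dlog_bound (dlog : Γ →+ Ser Γ) {A : Set Γ} (hA : FinGen A) :
    ∃ W : Set Γ, FinGen W ∧ W.IsPWO ∧ ∀ γ ∈ A, (dlog γ).toHahn.support ⊆ W := by
  obtain ⟨M, μ, k₀, -, hA⟩ := hA
  refine ⟨⋃ i ∈ (Finset.univ : Finset (Fin M)), (dlog (μ i)).toHahn.support,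
    FinGen.biUnion _ _ fun i => (dlog (μ i)).finGen,
    (Finset.isPWO_bUnion _).2 fun i _ => (dlog (μ i)).toHahn.isPWO_support, fun γ hγ a ha => ?_⟩
  obtain ⟨k, -, rfl⟩ := hA hγ
  by_contra hW
  have hz : ∀ i, (dlog (μ i)).toHahn.coeff a = 0 := by
    intro i
    by_contra h
    exact hW (Set.mem_biUnion (Finset.mem_coe.2 (Finset.mem_univ i)) h)
  refine ha ?_
  have : (dlog (∑ i, k i • μ i)).toHahn = ∑ i, k i • (dlog (μ i)).toHahn := by
    simp [map_sum, map_zsmul]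
  rw [this, HahnSeries.coeff_sum]
  exact Finset.sum_eq_zero fun i _ => by rw [HahnSeries.coeff_smul, hz i, smul_zero]

theorem term_mem (dlog : Γ →+ Ser Γ) (f : Ser Γ) {W : Set Γ}
    (hW : ∀ γ ∈ f.toHahn.support, (dlog γ).toHahn.support ⊆ W) (γ a : Γ)
    (ha : (HahnSeries.single γ (f.toHahn.coeff γ) * (dlog γ).toHahn).coeff a ≠ 0) :
    γ ∈ f.toHahn.support ∧ a - γ ∈ W := by
  rw [HahnSeries.coeff_single_mul] at ha
  have h₁ : γ ∈ f.toHahn.support := left_ne_zero_of_mul ha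
  exact ⟨h₁, hW γ h₁ (right_ne_zero_of_mul ha)⟩

/-- The summable family `c_γ D (t ^ γ)` of the derivatives of the terms of `f = ∑ c_γ t ^ γ`. -/
def derivFamily (dlog : Γ →+ Ser Γ) (f : Ser Γ) : HahnSeries.SummableFamily Γ ℝ Γ where
  toFun γ := HahnSeries.single γ (f.toHahn.coeff γ) * (dlog γ).toHahn
  isPWO_iUnion_support' := by
    obtain ⟨W, -, hW, h⟩ := exists_dlog_bound dlog f.finGen
    refine (f.toHahn.isPWO_support.add hW).mono (Set.iUnion_subset fun γ a ha => ?_)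
    obtain ⟨h₁, h₂⟩ := term_mem dlog f h γ a ha
    exact ⟨γ, h₁, a - γ, h₂, by simp⟩
  finite_co_support' a := by
    obtain ⟨W, -, hW, h⟩ := exists_dlog_bound dlog f.finGen
    refine ((Set.AddAntidiagonal.finite_of_isPWO f.toHahn.isPWO_support hW a).image Prod.fst).subset ?_
    intro γ ha
    obtain ⟨h₁, h₂⟩ := term_mem dlog f h γ a ha
    exact ⟨(γ, a - γ), ⟨h₁, h₂, by simp⟩, rfl⟩

/-- The derivative `D (∑ c_γ t ^ γ) = ∑ c_γ D (t ^ γ)`. -/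
def deriv (dlog : Γ →+ Ser Γ) : Ser Γ →+ Ser Γ where
  toFun f := ⟨(derivFamily dlog f).hsum, by
    obtain ⟨W, hfin, -, h⟩ := exists_dlog_bound dlog f.finGen
    refine (FinGen.add f.finGen hfin).mono (HahnSeries.SummableFamily.support_hsum_subset.trans
      (Set.iUnion_subset fun γ a ha => ?_))
    obtain ⟨h₁, h₂⟩ := term_mem dlog f h γ a ha
    exact ⟨γ, h₁, a - γ, h₂, by simp⟩⟩
  map_zero' := Ser.ext (by
    change (derivFamily dlog 0).hsum = 0
    ext a
    simp [derivFamily])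
  map_add' f g := Ser.ext (by
    change (derivFamily dlog (f + g)).hsum = (derivFamily dlog f).hsum + (derivFamily dlog g).hsum
    rw [← HahnSeries.SummableFamily.hsum_add]
    congr 1
    ext1 γ
    simp [derivFamily, add_mul])

theorem deriv_coeff (dlog : Γ →+ Ser Γ) (f : Ser Γ) (a : Γ) :
    (deriv dlog f).toHahn.coeff a = ∑ᶠ γ, f.toHahn.coeff γ * (dlog γ).toHahn.coeff (a - γ) := by
  change (derivFamily dlog f).hsum.coeff a = _
  rw [HahnSeries.SummableFamily.coeff_hsum]
  exact finsum_congr fun γ => HahnSeries.coeff_single_mul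

theorem deriv_emb (ι : Γ →+ Γ') (hι : StrictMono ι)
    (dlog : Γ →+ Ser Γ) (dlog' : Γ' →+ Ser Γ') (h : ∀ γ, dlog' (ι γ) = emb ι hι (dlog γ))
    (f : Ser Γ) : deriv dlog' (emb ι hι f) = emb ι hι (deriv dlog f) := by
  refine Ser.ext (HahnSeries.ext (funext fun a => ?_))
  have hsum : (deriv dlog' (emb ι hι f)).toHahn.coeff a =
      ∑ᶠ γ, f.toHahn.coeff γ * (emb ι hι (dlog γ)).toHahn.coeff (a - ι γ) := by
    have hsupp : (Function.support fun δ =>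
        (emb ι hι f).toHahn.coeff δ * (dlog' δ).toHahn.coeff (a - δ)) ⊆ Set.range ι := by
      intro δ hδ
      by_contra hr
      exact hδ (by simp only [emb_coeff_of_notMem ι hι f hr, zero_mul])
    have hrange := finsum_mem_inter_support_eq' (fun δ =>
        (emb ι hι f).toHahn.coeff δ * (dlog' δ).toHahn.coeff (a - δ)) (Set.range ι) Set.univ
        fun δ hδ => ⟨fun _ => trivial, fun _ => hsupp hδ⟩
    rw [deriv_coeff, ← finsum_mem_univ, ← hrange, finsum_mem_range hι.injective]
    exact finsum_congr fun γ => by rw [emb_coeff, h]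
  rw [hsum]
  by_cases ha : a ∈ Set.range ι
  · obtain ⟨a, rfl⟩ := ha
    rw [emb_coeff, deriv_coeff]
    exact finsum_congr fun γ => by rw [← map_sub, emb_coeff]
  · rw [emb_coeff_of_notMem ι hι _ ha]
    refine finsum_eq_zero_of_forall_eq_zero fun γ => ?_
    rw [emb_coeff_of_notMem, mul_zero]
    rintro ⟨b, hb⟩
    exact ha ⟨b + γ, by rw [map_add, hb, sub_add_cancel]⟩

/-- The exponent of the transmonomial `x ^ (-1)`. -/
def Mon.xInv : Mon Γ := Mon.mk 0 1

theorem Mon.map_xInv (ι : Γ →+ Γ') (hι : StrictMono ι) : Mon.map ι hι Mon.xInv = Mon.xInv :=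
  Mon.ext (map_zero (Large.map ι hι)) rfl

theorem mono_zero (γ : Γ) : mono γ 0 = 0 := Ser.ext (by simp)

theorem mono_add (γ : Γ) (c d : ℝ) : mono γ (c + d) = mono γ c + mono γ d :=
  Ser.ext (by simp)

/-- The logarithmic derivative of `x ^ (-σ) exp (-L)` is `-L' - σ x ^ (-1)`. Here `L'` is a series
over `Γ`, which `ι` embeds into the series over `Mon Γ`. -/
def Mon.dlog (ι : Γ →+ Mon Γ) (hι : StrictMono ι) (dlog : Γ →+ Ser Γ) :
    Mon Γ →+ Ser (Mon Γ) where
  toFun γ := -emb ι hι (deriv dlog γ.large.toSer) - mono Mon.xInv γ.pow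
  map_zero' := by simp [mono_zero]
  map_add' a b := by
    simp only [map_add, mono_add]
    abel

theorem Mon.dlog_map (ι : Γ →+ Mon Γ) (hι : StrictMono ι) (dlog : Γ →+ Ser Γ)
    (h : ∀ γ, Mon.dlog ι hι dlog (ι γ) = emb ι hι (dlog γ)) (γ : Mon Γ) :
    Mon.dlog (Mon.map ι hι) (Mon.map_strictMono ι hι) (Mon.dlog ι hι dlog) (Mon.map ι hι γ) =
      emb (Mon.map ι hι) (Mon.map_strictMono ι hι) (Mon.dlog ι hι dlog γ) := by
  change -emb (Mon.map ι hι) (Mon.map_strictMono ι hι)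
          (deriv (Mon.dlog ι hι dlog) (emb ι hι γ.large.toSer)) - mono Mon.xInv γ.pow =
      emb (Mon.map ι hι) (Mon.map_strictMono ι hι)
        (-emb ι hι (deriv dlog γ.large.toSer) - mono Mon.xInv γ.pow)
  rw [deriv_emb ι hι dlog _ h, map_sub, map_neg, emb_mono, Mon.map_xInv]

end FinGen

/-! ## The tower of levels -/

/-- The data that are carried along the construction: a group of transmonomials, its inclusion
into the next group, and the logarithmic derivatives of its elements. -/
structure Stage where
  Γ : Type
  [addCommGroup : AddCommGroup Γ]
  [linearOrder : LinearOrder Γ]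
  [isOrderedAddMonoid : IsOrderedAddMonoid Γ]
  incl : Γ →+ Mon Γ
  incl_strictMono : StrictMono incl
  dlog : Γ →+ Ser Γ

attribute [instance] Stage.addCommGroup Stage.linearOrder Stage.isOrderedAddMonoid

/-- The trivial group, whose only monomial is `1`; the series over it are the real constants. -/
def Stage.base : Stage where
  Γ := Unit
  incl := 0
  incl_strictMono := Subsingleton.strictMono _
  dlog := 0

/-- From the transmonomials of one level to those of the next. -/
def Stage.next (P : Stage) : Stage where
  Γ := Mon P.Γ
  incl := Mon.map P.incl P.incl_strictMono
  incl_strictMono := Mon.map_strictMono _ _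
  dlog := Mon.dlog P.incl P.incl_strictMono P.dlog

/-- The tower of transmonomial groups. Stage `0` is trivial, and there is no large series over it,
so that stage `1` consists of the powers `x ^ σ`, the transmonomials of level `0`. In general
stage `n + 1` is the group of transmonomials of level `n`. -/
def stage : ℕ → Stage
  | 0 => Stage.base
  | n + 1 => (stage n).next

/-- The differential algebra of series over the `n`-th transmonomial group: the constants
for `n = 0`, and the transseries of level at most `n - 1` for `n ≥ 1`. -/
abbrev Tr (n : ℕ) : Type := Ser (stage n).Γ

/-- The derivative on the series of a given stage. -/
def D (n : ℕ) : Tr n →+ Tr n := deriv (stage n).dlog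

/-- The natural embedding of each stage into the next. -/
def step (n : ℕ) : Tr n →ₐ[ℝ] Tr (n + 1) := emb (stage n).incl (stage n).incl_strictMono

/-- The natural embeddings between stages. -/
def trans (m n : ℕ) (h : m ≤ n) : Tr m →ₐ[ℝ] Tr n :=
  Nat.leRecOn h (fun {k} g => (step k).comp g) (AlgHom.id ℝ (Tr m))

theorem trans_self (m : ℕ) (f : Tr m) : trans m m le_rfl f = f := by
  rw [trans, Nat.leRecOn_self]
  rfl

theorem trans_succ (m n : ℕ) (h : m ≤ n) (f : Tr m) :
    trans m (n + 1) (Nat.le_succ_of_le h) f = step n (trans m n h f) := by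
  rw [trans, Nat.leRecOn_succ h]
  rfl

instance : DirectedSystem Tr (trans · · ·) where
  map_self m f := trans_self m f
  map_map n m k hkm hmn f := by
    induction n, hmn using Nat.le_induction with
    | base => rw [trans_self]
    | succ n hmn ih => rw [trans_succ m n hmn, ih, trans_succ k n (hkm.trans hmn)]

theorem dlog_incl (n : ℕ) (γ : (stage n).Γ) :
    (stage n).next.dlog ((stage n).incl γ) =
      emb (stage n).incl (stage n).incl_strictMono ((stage n).dlog γ) := by
  induction n with
  | zero =>
    change (stage 0).next.dlog 0 = emb _ _ 0
    rw [map_zero, map_zero]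
  | succ n ih => exact Mon.dlog_map _ _ _ ih γ

theorem trans_D (m n : ℕ) (h : m ≤ n) (f : Tr m) :
    trans m n h (D m f) = D n (trans m n h f) := by
  induction n, h using Nat.le_induction with
  | base => rw [trans_self, trans_self]
  | succ n h ih =>
    rw [trans_succ m n h, trans_succ m n h, ih]
    exact (deriv_emb _ _ _ _ (dlog_incl n) _).symm

end LogFree

open LogFree

/-! ## Log-free transseries -/

/-- The space of log-free transseries (with real coefficients), the union of the levels, i.e.
their inductive limit along the natural embeddings. -/
abbrev Transseries : Type := DirectLimit Tr trans

namespace Transseries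

/-- The transseries given by a series of stage `n`. -/
def of (n : ℕ) (f : Tr n) : Transseries := ⟦⟨n, f⟩⟧

/-- The constant transseries. -/
def const (c : ℝ) : Transseries := of 0 (algebraMap ℝ (Tr 0) c)

/-- Differentiation `d/dx`. -/
def D : Transseries → Transseries :=
  DirectLimit.map trans trans (fun n => LogFree.D n) trans_D

/-- `T` is large: all its transmonomials are `≫ 1` (this allows `T = 0`). -/
def IsLarge (T : Transseries) : Prop := ∃ n f, T = of n f ∧ IsLargeSer f

/-- `T` is small: all its transmonomials are `≪ 1` (this allows `T = 0`). -/
def IsSmall (T : Transseries) : Prop := ∃ n f, T = of n f ∧ IsSmallSer f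

/-- `T₁ ≫ T₂`, i.e. `mag T₁ ≫ mag T₂`, with `mag 0 = 0`. -/
def Dominates (T₁ T₂ : Transseries) : Prop :=
  ∃ n f g, T₁ = of n f ∧ T₂ = of n g ∧ DomSer f g

end Transseries

/-- `T₁ ≫ₜ T₂`: the transseries `T₁` dominates `T₂`. -/
infix:50 " ≫ₜ " => Transseries.Dominates

end

namespace LogFree

/-! ### Orders of series: embeddings, large and small series, comparison of large series. -/

section Series

variable {Γ Γ' : Type} [AddCommGroup Γ] [LinearOrder Γ] [IsOrderedAddMonoid Γ]
  [AddCommGroup Γ'] [LinearOrder Γ'] [IsOrderedAddMonoid Γ']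

/-! On series without constant term, differentiation acts on dominant exponents through one strictly
increasing map `φ γ = γ + lam γ`, where `t ^ (lam γ)` is the magnitude of the logarithmic derivative
of `t ^ γ` (`orderTop_deriv`). Large and small series have no constant term, so all three
comparisons of derivatives reduce to comparisons of the series, and a large nonzero series always
dominates a small one. If `D f = 0`, subtracting the constant term leaves a series whose order `φ`
sends to `⊤`; hence that series is zero.

The work is the monotonicity of `φ`, by induction on stages (`IsAsymptotic.strictMono_next`). At the
next stage `lam` is `φ` of the order of `L`. When this correction moves the wrong way, it must be
beaten by the gap between the two exponents `L`. That holds because the logarithm of a derivative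
`(t ^ b)'` is dominated by `t ^ b` if `t ^ b ≫ 1`. The induction therefore also carries the growth
bounds `lt_log` and `lt_log_lam`. -/

theorem orderTop_emb (ι : Γ →+ Γ') (hι : StrictMono ι) (f : Ser Γ) :
    (emb ι hι f).toHahn.orderTop = f.toHahn.orderTop.map ι :=
  HahnSeries.orderTop_embDomain

theorem toHahn_eq_zero {f : Ser Γ} : f.toHahn = 0 ↔ f = 0 :=
  ⟨fun h => Ser.ext (h.trans (map_zero Ser.toHahn).symm), fun h => by rw [h, map_zero]⟩

theorem IsLargeSer.coeff_zero {f : Ser Γ} (hf : IsLargeSer f) : f.toHahn.coeff 0 = 0 := by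
  by_contra h
  exact lt_irrefl _ (hf 0 h)

theorem IsSmallSer.coeff_zero {f : Ser Γ} (hf : IsSmallSer f) : f.toHahn.coeff 0 = 0 := by
  by_contra h
  exact lt_irrefl _ (hf 0 h)

theorem IsLargeSer.order_neg {f : Ser Γ} (hf : IsLargeSer f) (h0 : f.toHahn ≠ 0) :
    f.toHahn.order < 0 := by
  refine hf _ ?_
  rwa [← HahnSeries.leadingCoeff_eq, HahnSeries.leadingCoeff_ne_zero]

/-- The exponent `0` of the monomial `1` separates the two orders. -/
theorem IsLargeSer.domSer_of_isSmallSer {f g : Ser Γ} (hf : IsLargeSer f) (h0 : f ≠ 0)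
    (hg : IsSmallSer g) : DomSer f g := by
  have hne : f.toHahn ≠ 0 := fun h => h0 (toHahn_eq_zero.1 h)
  refine lt_of_lt_of_le (b := ((0 : Γ) : WithTop Γ)) ?_ ?_
  · rw [← HahnSeries.order_eq_orderTop_of_ne_zero hne, WithTop.coe_lt_coe]
    exact hf.order_neg hne
  · rw [HahnSeries.le_orderTop_iff_forall]
    intro γ hγ
    by_contra h
    exact lt_asymm (hg γ h) (WithTop.coe_lt_coe.1 hγ)

theorem exists_of_coeff_emb_ne_zero (ι : Γ →+ Γ') (hι : StrictMono ι) {f : Ser Γ} {γ : Γ'}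
    (h : (emb ι hι f).toHahn.coeff γ ≠ 0) : ∃ δ, ι δ = γ ∧ f.toHahn.coeff δ ≠ 0 := by
  by_cases hγ : γ ∈ Set.range ι
  · obtain ⟨δ, rfl⟩ := hγ
    exact ⟨δ, rfl, by rwa [emb_coeff] at h⟩
  · exact absurd (emb_coeff_of_notMem ι hι f hγ) h

theorem IsLargeSer.emb (ι : Γ →+ Γ') (hι : StrictMono ι) {f : Ser Γ} (hf : IsLargeSer f) :
    IsLargeSer (emb ι hι f) := by
  intro γ h
  obtain ⟨δ, rfl, hδ⟩ := exists_of_coeff_emb_ne_zero ι hι h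
  simpa using hι (hf δ hδ)

theorem IsSmallSer.emb (ι : Γ →+ Γ') (hι : StrictMono ι) {f : Ser Γ} (hf : IsSmallSer f) :
    IsSmallSer (emb ι hι f) := by
  intro γ h
  obtain ⟨δ, rfl, hδ⟩ := exists_of_coeff_emb_ne_zero ι hι h
  simpa using hι (hf δ hδ)

theorem domSer_emb (ι : Γ →+ Γ') (hι : StrictMono ι) {f g : Ser Γ} :
    DomSer (emb ι hι f) (emb ι hι g) ↔ DomSer f g := by
  rw [DomSer, orderTop_emb, orderTop_emb]
  exact (WithTop.strictMono_map_iff.2 hι).lt_iff_lt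

theorem lt_orderTop_add {f g : Ser Γ} {γ : WithTop Γ} (hf : γ < f.toHahn.orderTop)
    (hg : γ < g.toHahn.orderTop) : γ < (f + g).toHahn.orderTop := by
  rw [map_add]
  exact (lt_min hf hg).trans_le HahnSeries.min_orderTop_le_orderTop_add

/-- Subtracting a dominated series does not change the leading coefficient. -/
theorem Large.lt_of_orderTop_lt {X N : Large Γ} (hX : 0 < X)
    (h : X.toSer.toHahn.orderTop < N.toSer.toHahn.orderTop) : N < X := by
  rw [Large.lt_iff] at hX ⊢
  rw [HahnSeries.leadingCoeff_sub h]
  simpa using hX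

/-- Equality occurs only for `L = 0`, whose `order` is `0` by convention. -/
theorem Large.order_nonpos (L : Large Γ) : L.toSer.toHahn.order ≤ 0 := by
  by_cases h : L.toSer.toHahn = 0
  · simp [h]
  · exact (L.isLargeSer.order_neg h).le

theorem Large.toHahn_eq_zero {L : Large Γ} : L.toSer.toHahn = 0 ↔ L = 0 := by
  rw [LogFree.toHahn_eq_zero]
  exact ⟨fun h => Large.toSer_injective (h.trans (map_zero _).symm), fun h => by rw [h, map_zero]⟩

/-! ### The order of a derivative. -/

/-- If `γ ↦ φ γ`, the order of the derivative of `t ^ γ`, is strictly monotone on nonzero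
exponents, then a series without constant term is differentiated on the level of orders by `φ`. -/
theorem orderTop_deriv (dlog : Γ →+ Ser Γ) (lam : Γ → Γ)
    (hlam : ∀ γ, γ ≠ 0 → (dlog γ).toHahn.orderTop = lam γ)
    (hmono : StrictMono fun γ => γ + lam γ) {f : Ser Γ} (hf : f.toHahn.coeff 0 = 0) :
    (deriv dlog f).toHahn.orderTop = f.toHahn.orderTop.map fun γ => γ + lam γ := by
  by_cases h0 : f = 0
  · simp [h0]
  have hne : f.toHahn ≠ 0 := fun h => h0 (toHahn_eq_zero.1 h)
  have hord := HahnSeries.order_eq_orderTop_of_ne_zero hne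
  set a := f.toHahn.order with ha
  have hlead : f.toHahn.coeff a ≠ 0 := by
    rwa [ha, ← HahnSeries.leadingCoeff_eq, HahnSeries.leadingCoeff_ne_zero]
  have ha0 : a ≠ 0 := fun h => hlead (h ▸ hf)
  -- Up to the exponent `φ a`, the only possible contribution is that of the leading term at `φ a`
  -- itself: any other term of `f` starts at `φ γ > φ a`, and `γ = 0` does not occur.
  have key : ∀ b ≤ a + lam a, ∀ γ, γ ≠ a ∨ b ≠ a + lam a →
      f.toHahn.coeff γ * (dlog γ).toHahn.coeff (b - γ) = 0 := by
    intro b hb γ hγ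
    by_cases hc : f.toHahn.coeff γ = 0
    · rw [hc, zero_mul]
    have hγ0 : γ ≠ 0 := fun h => hc (h ▸ hf)
    have hle : a ≤ γ := by
      have := HahnSeries.orderTop_le_of_coeff_ne_zero hc
      rw [← hord] at this
      exact WithTop.coe_le_coe.1 this
    rw [HahnSeries.coeff_eq_zero_of_lt_orderTop (x := (dlog γ).toHahn), mul_zero]
    rw [hlam γ hγ0, WithTop.coe_lt_coe, sub_lt_iff_lt_add']
    rcases hle.eq_or_lt with rfl | hlt
    · exact lt_of_le_of_ne hb (hγ.resolve_left fun h => h rfl)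
    · exact hb.trans_lt (hmono hlt)
  rw [← hord, WithTop.map_coe]
  apply le_antisymm
  -- The coefficient at `φ a` is the product of the leading coefficients of `f` and of `dlog a`.
  · apply HahnSeries.orderTop_le_of_coeff_ne_zero
    rw [deriv_coeff, finsum_eq_single _ a fun γ hγ => key _ le_rfl γ (Or.inl hγ)]
    rw [add_sub_cancel_left]
    exact mul_ne_zero hlead (HahnSeries.coeff_orderTop_ne (hlam a ha0))
  · rw [HahnSeries.le_orderTop_iff_forall]
    intro b hb
    have hb := WithTop.coe_lt_coe.1 hb
    rw [deriv_coeff]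
    exact finsum_eq_zero_of_forall_eq_zero fun γ => key b hb.le γ (Or.inr hb.ne)

/-! ### The invariants of a stage and their first consequences. -/

/-- The asymptotic invariants of a stage. `lam γ` is the exponent of the logarithmic derivative of
`t ^ γ`, with the exponent of `x ^ (-1)` as its value at `0`; the last two fields say that
`log (t ^ γ)` and the logarithm of the dominant monomial of its logarithmic derivative are
dominated by `t ^ γ` when `t ^ γ ≫ 1`. -/
structure IsAsymptotic (P : Stage) (lam : P.Γ → P.Γ) : Prop where
  orderTop_dlog : ∀ γ, γ ≠ 0 → (P.dlog γ).toHahn.orderTop = lam γ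
  incl_lam_zero : P.incl (lam 0) = Mon.xInv
  strictMono : StrictMono fun γ => γ + lam γ
  lt_log : ∀ γ : P.Γ, γ < 0 → (γ : WithTop P.Γ) < (P.incl γ).large.toSer.toHahn.orderTop
  lt_log_lam : ∀ γ : P.Γ, γ < 0 → (γ : WithTop P.Γ) < (P.incl (lam γ)).large.toSer.toHahn.orderTop

theorem IsAsymptotic.orderTop_D {P : Stage} {lam : P.Γ → P.Γ} (h : IsAsymptotic P lam)
    {f : Ser P.Γ} (hf : f.toHahn.coeff 0 = 0) :
    (deriv P.dlog f).toHahn.orderTop = f.toHahn.orderTop.map fun γ => γ + lam γ :=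
  orderTop_deriv P.dlog lam h.orderTop_dlog h.strictMono hf

/-- The logarithm of a derivative splits into the logarithms of the monomial and of its logarithmic
derivative, each covered by one growth bound. -/
theorem IsAsymptotic.lt_log_deriv {P : Stage} {lam : P.Γ → P.Γ} (h : IsAsymptotic P lam)
    {γ : P.Γ} (hγ : γ < 0) :
    (γ : WithTop P.Γ) < (P.incl (γ + lam γ)).large.toSer.toHahn.orderTop := by
  rw [map_add, map_add, map_add]
  exact lt_orderTop_add (h.lt_log γ hγ) (h.lt_log_lam γ hγ)

/-- This version admits `γ = 0`, the default order of a vanishing `L`. There `φ 0` is the exponent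
of `x ^ (-1)`, which has no exponential part. -/
theorem IsAsymptotic.lt_log_deriv_of_lt {P : Stage} {lam : P.Γ → P.Γ} (h : IsAsymptotic P lam)
    {β γ : P.Γ} (hβ : β < γ) (hγ : γ ≤ 0) :
    (β : WithTop P.Γ) < (P.incl (γ + lam γ)).large.toSer.toHahn.orderTop := by
  rcases hγ.eq_or_lt with rfl | hγ
  · rw [zero_add, h.incl_lam_zero]
    simp [Mon.xInv]
  · exact (WithTop.coe_lt_coe.2 hβ).trans (h.lt_log_deriv hγ)

/-- `incl γ`, for `γ = ord L`, is the exponent of the dominant monomial of `L`, and `L ≪ exp L`. -/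
theorem IsAsymptotic.lt_incl_order {P : Stage} {lam : P.Γ → P.Γ} (h : IsAsymptotic P lam)
    {γ : Mon P.Γ} (hγ : γ < 0) (hL : γ.large ≠ 0) : γ < P.incl γ.large.toSer.toHahn.order := by
  rw [Mon.lt_iff] at hγ ⊢
  left
  have hneg : γ.large < 0 := hγ.resolve_right fun h => hL h.1
  have hne : γ.large.toSer.toHahn ≠ 0 := fun h => hL (Large.toHahn_eq_zero.1 h)
  have ha : γ.large.toSer.toHahn.order < 0 := γ.large.isLargeSer.order_neg hne
  -- After the sign change, the positive series `-γ.large` has to exceed one that it dominates by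
  -- `lt_log`.
  rw [← neg_lt_neg_iff]
  refine Large.lt_of_orderTop_lt (neg_pos.2 hneg) ?_
  rw [map_neg, map_neg, map_neg, map_neg, HahnSeries.orderTop_neg, HahnSeries.orderTop_neg,
    ← HahnSeries.order_eq_orderTop_of_ne_zero hne]
  exact h.lt_log _ ha

theorem IsAsymptotic.orderTop_deriv_large {P : Stage} {lam : P.Γ → P.Γ}
    (h : IsAsymptotic P lam) {L : Large P.Γ} (hL : L ≠ 0) :
    (deriv P.dlog L.toSer).toHahn.orderTop =
      (L.toSer.toHahn.order + lam L.toSer.toHahn.order : P.Γ) := by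
  rw [h.orderTop_D, ← HahnSeries.order_eq_orderTop_of_ne_zero, WithTop.map_coe]
  · exact fun h' => hL (Large.toHahn_eq_zero.1 h')
  · exact L.isLargeSer.coeff_zero

/-! ### Passage to the next stage. -/

/-- The exponent of the logarithmic derivative at the next stage. -/
noncomputable def lamNext (P : Stage) (lam : P.Γ → P.Γ) (γ : Mon P.Γ) : Mon P.Γ :=
  P.incl (γ.large.toSer.toHahn.order + lam γ.large.toSer.toHahn.order)

/-- The convention `order 0 = 0` and the choice of `lam 0` make the uniform formula correct for pure
powers of `x`. -/
theorem IsAsymptotic.lamNext_of_large_eq_zero {P : Stage} {lam : P.Γ → P.Γ}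
    (h : IsAsymptotic P lam) {γ : Mon P.Γ} (hγ : γ.large = 0) : lamNext P lam γ = Mon.xInv := by
  simp [lamNext, hγ, h.incl_lam_zero]

theorem IsAsymptotic.orderTop_dlog_next {P : Stage} {lam : P.Γ → P.Γ} (h : IsAsymptotic P lam)
    {γ : Mon P.Γ} (hγ : γ ≠ 0) :
    (Mon.dlog P.incl P.incl_strictMono P.dlog γ).toHahn.orderTop = lamNext P lam γ := by
  change (-emb P.incl P.incl_strictMono (deriv P.dlog γ.large.toSer) -
    mono Mon.xInv γ.pow).toHahn.orderTop = _
  by_cases hL : γ.large = 0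
  · have hσ : γ.pow ≠ 0 := fun h' => hγ (Mon.ext hL h')
    rw [h.lamNext_of_large_eq_zero hL, hL]
    simp only [map_zero, neg_zero, zero_sub, map_neg, HahnSeries.orderTop_neg, toHahn_mono]
    exact HahnSeries.orderTop_single hσ
  · have hne : γ.large.toSer.toHahn ≠ 0 := fun h => hL (Large.toHahn_eq_zero.1 h)
    have ha : γ.large.toSer.toHahn.order < 0 := γ.large.isLargeSer.order_neg hne
    have hord : (-(emb P.incl P.incl_strictMono (deriv P.dlog γ.large.toSer)).toHahn).orderTop =
        lamNext P lam γ := by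
      rw [HahnSeries.orderTop_neg, orderTop_emb, h.orderTop_deriv_large hL, WithTop.map_coe]
      rfl
    rw [map_sub, map_neg, HahnSeries.orderTop_sub, hord]
    rw [hord, toHahn_mono]
    refine HahnSeries.lt_orderTop_single ?_
    -- `L'` dominates `x ^ (-1)`, since `φ (ord L) < φ 0 = lam 0`; so the two summands cannot
    -- cancel.
    rw [← h.incl_lam_zero]
    refine P.incl_strictMono ?_
    simpa using h.strictMono ha

theorem IsAsymptotic.strictMono_next {P : Stage} {lam : P.Γ → P.Γ} (h : IsAsymptotic P lam) :
    StrictMono fun γ : Mon P.Γ => γ + lamNext P lam γ := by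
  intro γ δ hlt
  rcases (Mon.lt_iff _ _).1 hlt with hL | ⟨hL, -⟩
  · change γ + lamNext P lam γ < δ + lamNext P lam δ
    set a := γ.large.toSer.toHahn.order with ha
    set b := δ.large.toSer.toHahn.order with hb
    -- If `a ≤ b`, the corrections `incl (φ a)` and `incl (φ b)` are ordered the right way already.
    rcases le_or_gt a b with hab | hab
    · exact add_lt_add_of_lt_of_le hlt
        (P.incl_strictMono.monotone (h.strictMono.monotone hab))
    have ha0 : a ≤ 0 := γ.large.order_nonpos
    have hne : δ.large.toSer.toHahn ≠ 0 := by
      intro h'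
      rw [h', HahnSeries.order_zero] at hb
      exact (hab.trans_le ha0).ne hb
    have hbo : δ.large.toSer.toHahn.orderTop = b :=
      (HahnSeries.order_eq_orderTop_of_ne_zero hne).symm
    have hao : (b : WithTop P.Γ) < γ.large.toSer.toHahn.orderTop := by
      by_cases h' : γ.large.toSer.toHahn = 0
      · simp [h']
      · rw [← HahnSeries.order_eq_orderTop_of_ne_zero h']
        exact WithTop.coe_lt_coe.2 hab
    rw [Mon.lt_iff]
    left
    -- Here `b < a`, so the positive series `δ.large - γ.large` has order exactly `b`, while both
    -- exponential parts on the left have order beyond `b`.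
    have hN : (P.incl (a + lam a)).large - (P.incl (b + lam b)).large <
        δ.large - γ.large := by
      refine Large.lt_of_orderTop_lt (sub_pos.2 hL) ?_
      rw [map_sub, map_sub, HahnSeries.orderTop_sub (by rwa [hbo]), hbo, sub_eq_add_neg, map_add]
      refine lt_orderTop_add (h.lt_log_deriv_of_lt hab ha0) ?_
      rw [map_neg, map_neg, HahnSeries.orderTop_neg]
      exact h.lt_log_deriv (hab.trans_le ha0)
    rw [map_add, map_add]
    change γ.large + (P.incl (a + lam a)).large < δ.large + (P.incl (b + lam b)).large
    rwa [sub_lt_sub_iff, add_comm] at hN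
  · simpa [lamNext, hL] using hlt

theorem IsAsymptotic.next {P : Stage} {lam : P.Γ → P.Γ} (h : IsAsymptotic P lam) :
    IsAsymptotic P.next (lamNext P lam) where
  orderTop_dlog _ hγ := h.orderTop_dlog_next hγ
  incl_lam_zero := by
    exact (congrArg (Mon.map P.incl P.incl_strictMono)
      (h.lamNext_of_large_eq_zero (γ := 0) (map_zero _))).trans (Mon.map_xInv _ _)
  strictMono := h.strictMono_next
  lt_log (γ : Mon P.Γ) hγ := by
    change _ < (emb P.incl P.incl_strictMono γ.large.toSer).toHahn.orderTop
    rw [orderTop_emb]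
    by_cases hL : γ.large = 0
    · rw [hL, map_zero, map_zero, HahnSeries.orderTop_zero]
      exact WithTop.coe_lt_top _
    · rw [← HahnSeries.order_eq_orderTop_of_ne_zero fun h' => hL (Large.toHahn_eq_zero.1 h'),
        WithTop.map_coe]
      exact WithTop.coe_lt_coe.2 (h.lt_incl_order hγ hL)
  lt_log_lam (γ : Mon P.Γ) hγ := by
    change _ < (emb P.incl P.incl_strictMono (lamNext P lam γ).large.toSer).toHahn.orderTop
    rw [orderTop_emb]
    by_cases hL : γ.large = 0
    · rw [h.lamNext_of_large_eq_zero hL, Mon.xInv, Mon.large_mk, map_zero, map_zero,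
        HahnSeries.orderTop_zero]
      exact WithTop.coe_lt_top _
    -- With `a` the order of `L`, the monomial of `γ` dominates `t ^ a`, which in turn dominates the
    -- exponential part of `φ a` by `lt_log_deriv`.
    · refine (WithTop.coe_lt_coe.2 (h.lt_incl_order hγ hL)).trans ?_
      have ha : γ.large.toSer.toHahn.order < 0 :=
        γ.large.isLargeSer.order_neg fun h' => hL (Large.toHahn_eq_zero.1 h')
      have := WithTop.strictMono_map_iff.2 P.incl_strictMono (h.lt_log_deriv ha)
      rwa [WithTop.map_coe] at this

/-! ### The powers of `x`, where the induction starts. -/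

theorem large_base_eq_zero (L : Large Stage.base.Γ) : L = 0 := by
  rw [← Large.toHahn_eq_zero]
  ext γ
  by_contra h
  exact (L.isLargeSer γ h).ne (Subsingleton.elim (α := Unit) _ _)

/-- Every nontrivial power of `x` has logarithmic derivative of magnitude `x ^ (-1)`, so `φ` is a
translation; the growth bounds hold because all exponential parts vanish. The trivial stage cannot
serve as the start, as it does not contain `x ^ (-1)`. -/
theorem isAsymptotic_base_next : IsAsymptotic Stage.base.next fun _ => Mon.xInv where
  orderTop_dlog (γ : Mon Stage.base.Γ) hγ := by
    change (-emb Stage.base.incl Stage.base.incl_strictMono (deriv Stage.base.dlog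
      γ.large.toSer) - mono Mon.xInv γ.pow).toHahn.orderTop = _
    have hσ : γ.pow ≠ 0 := fun h' => hγ (Mon.ext (large_base_eq_zero _) h')
    rw [large_base_eq_zero γ.large]
    simp only [map_zero, neg_zero, zero_sub, map_neg, HahnSeries.orderTop_neg, toHahn_mono]
    exact HahnSeries.orderTop_single hσ
  incl_lam_zero := Mon.map_xInv _ _
  strictMono := fun _ _ h => add_lt_add_left h _
  lt_log (γ : Mon Stage.base.Γ) _ := by
    change _ < (emb Stage.base.incl Stage.base.incl_strictMono γ.large.toSer).toHahn.orderTop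
    rw [large_base_eq_zero γ.large, map_zero, map_zero, map_zero, HahnSeries.orderTop_zero]
    exact WithTop.coe_lt_top _
  lt_log_lam (γ : Mon Stage.base.Γ) _ := by
    change _ < (emb Stage.base.incl Stage.base.incl_strictMono
      (Mon.xInv : Mon Stage.base.Γ).large.toSer).toHahn.orderTop
    rw [large_base_eq_zero (Mon.large _), map_zero, map_zero, map_zero, HahnSeries.orderTop_zero]
    exact WithTop.coe_lt_top _

end Series

/-! ### Dominance and constants at a fixed stage. -/

theorem exists_isAsymptotic (n : ℕ) : ∃ lam, IsAsymptotic (stage (n + 1)) lam := by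
  induction n with
  | zero => exact ⟨_, isAsymptotic_base_next⟩
  | succ n ih =>
    obtain ⟨lam, h⟩ := ih
    exact ⟨_, h.next⟩

/-- At each positive stage, differentiation acts on the orders of series without constant term
through a strictly monotone function. -/
theorem exists_orderTop_D {n : ℕ} (hn : n ≠ 0) : ∃ φ : (stage n).Γ → (stage n).Γ, StrictMono φ ∧
    ∀ f : Tr n, f.toHahn.coeff 0 = 0 →
      (D n f).toHahn.orderTop = f.toHahn.orderTop.map φ := by
  obtain ⟨m, rfl⟩ := Nat.exists_eq_succ_of_ne_zero hn
  obtain ⟨lam, h⟩ := exists_isAsymptotic m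
  exact ⟨_, h.strictMono, fun f hf => h.orderTop_D hf⟩

theorem domSer_D_iff {n : ℕ} (hn : n ≠ 0) {f g : Tr n} (hf : f.toHahn.coeff 0 = 0)
    (hg : g.toHahn.coeff 0 = 0) : DomSer (D n f) (D n g) ↔ DomSer f g := by
  obtain ⟨φ, hφ, h⟩ := exists_orderTop_D hn
  rw [DomSer, h f hf, h g hg]
  exact (WithTop.strictMono_map_iff.2 hφ).lt_iff_lt

theorem D_algebraMap (n : ℕ) (c : ℝ) : D n (algebraMap ℝ (Tr n) c) = 0 := by
  refine toHahn_eq_zero.1 (HahnSeries.ext (funext fun a => ?_))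
  rw [D, deriv_coeff, HahnSeries.coeff_zero]
  refine finsum_eq_zero_of_forall_eq_zero fun γ => ?_
  by_cases hγ : γ = 0
  · simp [hγ]
  · rw [AlgHom.commutes, HahnSeries.algebraMap_apply, HahnSeries.C_apply,
      HahnSeries.coeff_single_of_ne hγ, zero_mul]

theorem eq_algebraMap_of_D_eq_zero {n : ℕ} (hn : n ≠ 0) {f : Tr n} (h : D n f = 0) :
    f = algebraMap ℝ (Tr n) (f.toHahn.coeff 0) := by
  obtain ⟨φ, -, hφ⟩ := exists_orderTop_D hn
  have hc : (f - algebraMap ℝ (Tr n) (f.toHahn.coeff 0)).toHahn.coeff 0 = 0 := by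
    rw [map_sub, AlgHom.commutes]
    simp [HahnSeries.algebraMap_apply]
  -- The difference has derivative zero, and `WithTop.map φ` takes the value `⊤` only at `⊤`.
  have := hφ _ hc
  rw [map_sub, h, D_algebraMap, sub_zero, map_zero, HahnSeries.orderTop_zero, eq_comm,
    WithTop.map_eq_top_iff, HahnSeries.orderTop_eq_top, toHahn_eq_zero, sub_eq_zero] at this
  exact this

/-! ### Invariance under the embeddings between stages. -/

theorem IsLargeSer.trans {m n : ℕ} (h : m ≤ n) {f : Tr m} (hf : IsLargeSer f) :
    IsLargeSer (trans m n h f) := by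
  induction n, h using Nat.le_induction with
  | base => rwa [trans_self]
  | succ n h ih =>
    rw [trans_succ m n h]
    exact ih.emb _ _

theorem IsSmallSer.trans {m n : ℕ} (h : m ≤ n) {f : Tr m} (hf : IsSmallSer f) :
    IsSmallSer (trans m n h f) := by
  induction n, h using Nat.le_induction with
  | base => rwa [trans_self]
  | succ n h ih =>
    rw [trans_succ m n h]
    exact ih.emb _ _

theorem domSer_trans {m n : ℕ} (h : m ≤ n) {f g : Tr m} :
    DomSer (trans m n h f) (trans m n h g) ↔ DomSer f g := by
  induction n, h using Nat.le_induction with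
  | base => rw [trans_self, trans_self]
  | succ n h ih =>
    rw [trans_succ m n h, trans_succ m n h, ← ih]
    exact domSer_emb _ _

/-- Being nonzero means dominating `0`, and dominance is preserved. -/
theorem trans_injective {m n : ℕ} (h : m ≤ n) : Function.Injective (trans m n h) := by
  refine (injective_iff_map_eq_zero _).2 fun f hf => ?_
  by_contra hne
  have : DomSer (trans m n h f) (trans m n h 0) := by
    rw [domSer_trans, DomSer, map_zero, HahnSeries.orderTop_zero, HahnSeries.orderTop_lt_top]
    exact fun h' => hne (toHahn_eq_zero.1 h')
  rw [hf, map_zero] at this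
  exact lt_irrefl _ this

end LogFree

/-! ### The inductive limit. -/

namespace Transseries

open LogFree

theorem of_trans {m n : ℕ} (h : m ≤ n) (f : Tr m) : of n (trans m n h f) = of m f :=
  (DirectLimit.eq_of_le (f := trans) ⟨m, f⟩ n h).symm

theorem of_injective (n : ℕ) : Function.Injective (of n) :=
  DirectLimit.mk_injective trans (fun _ _ h => trans_injective h) n

theorem D_of (n : ℕ) (f : Tr n) : (of n f).D = of n (LogFree.D n f) := rfl

theorem of_zero (n : ℕ) : of n 0 = 0 :=
  (DirectLimit.zero_def (f := trans) n).symm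

/-- The witnesses of dominance may live at another stage `m`; both pairs agree at stage `n + m`,
where dominance can be read off. -/
theorem dominates_of {n : ℕ} {f g : Tr n} : of n f ≫ₜ of n g ↔ DomSer f g := by
  refine ⟨?_, fun h => ⟨n, f, g, rfl, rfl, h⟩⟩
  rintro ⟨m, f', g', hf, hg, h⟩
  have hn : n ≤ n + m := Nat.le_add_right n m
  have hm : m ≤ n + m := Nat.le_add_left m n
  rw [← of_trans hn, ← of_trans hm] at hf hg
  rwa [← domSer_trans hn, of_injective _ hf, of_injective _ hg, domSer_trans hm]

theorem const_eq_of (n : ℕ) (c : ℝ) : const c = of n (algebraMap ℝ (Tr n) c) := by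
  rw [const, ← of_trans (Nat.zero_le n), AlgHom.commutes]

theorem IsLarge.exists_of {T : Transseries} (h : T.IsLarge) :
    ∃ N, ∀ n, N ≤ n → ∃ f : Tr n, T = of n f ∧ IsLargeSer f := by
  obtain ⟨N, f, rfl, hf⟩ := h
  exact ⟨N, fun n hn => ⟨_, (of_trans hn f).symm, hf.trans hn⟩⟩

theorem IsSmall.exists_of {T : Transseries} (h : T.IsSmall) :
    ∃ N, ∀ n, N ≤ n → ∃ f : Tr n, T = of n f ∧ IsSmallSer f := by
  obtain ⟨N, f, rfl, hf⟩ := h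
  exact ⟨N, fun n hn => ⟨_, (of_trans hn f).symm, hf.trans hn⟩⟩

theorem dominates_D_of_iff {n : ℕ} {f g : Tr (n + 1)} (hf : f.toHahn.coeff 0 = 0)
    (hg : g.toHahn.coeff 0 = 0) : (of _ f).D ≫ₜ (of _ g).D ↔ of _ f ≫ₜ of _ g := by
  rw [D_of, D_of, dominates_of, dominates_of, domSer_D_iff n.succ_ne_zero hf hg]

theorem D_eq_zero_iff (T : Transseries) : T.D = 0 ↔ ∃ c : ℝ, T = const c := by
  constructor
  · obtain ⟨n, f, rfl⟩ := DirectLimit.exists_eq_mk trans T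
    change (of n f).D = 0 → ∃ c, of n f = const c
    -- Moving up one stage guarantees a positive stage, where `φ` is available.
    rw [← of_trans n.le_succ, D_of, ← of_zero (n + 1)]
    intro h
    exact ⟨_, (congrArg (of (n + 1)) (eq_algebraMap_of_D_eq_zero n.succ_ne_zero
      (of_injective _ h))).trans (const_eq_of (n + 1) _).symm⟩
  · rintro ⟨c, rfl⟩
    rw [const, D_of, D_algebraMap, of_zero]

end Transseries

theorem mainTheorem5 :
    (∀ L₁ L₂ : Transseries, L₁.IsLarge → L₂.IsLarge →
      (L₁ ≫ₜ L₂ ↔ L₁.D ≫ₜ L₂.D)) ∧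
    (∀ S₁ S₂ : Transseries, S₁.IsSmall → S₂.IsSmall →
      (S₁ ≫ₜ S₂ ↔ S₁.D ≫ₜ S₂.D)) ∧
    (∀ L S : Transseries, L.IsLarge → L ≠ 0 → S.IsSmall → L.D ≫ₜ S.D) ∧
    (∀ T : Transseries, T.D = 0 ↔ ∃ c : ℝ, T = Transseries.const c) := by
  refine ⟨fun L₁ L₂ h₁ h₂ => ?_, fun S₁ S₂ h₁ h₂ => ?_, fun L S h₁ h0 h₂ => ?_,
    Transseries.D_eq_zero_iff⟩ <;>
  obtain ⟨N₁, h₁⟩ := h₁.exists_of <;>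
  obtain ⟨N₂, h₂⟩ := h₂.exists_of <;>
  -- A common stage for both transseries; the `+ 1` makes it positive.
  obtain ⟨f, rfl, hf⟩ := h₁ (N₁ + N₂ + 1) (by omega) <;>
  obtain ⟨g, rfl, hg⟩ := h₂ (N₁ + N₂ + 1) (by omega)
  · exact (Transseries.dominates_D_of_iff hf.coeff_zero hg.coeff_zero).symm
  · exact (Transseries.dominates_D_of_iff hf.coeff_zero hg.coeff_zero).symm
  · rw [Transseries.dominates_D_of_iff hf.coeff_zero hg.coeff_zero, Transseries.dominates_of]
    exact hf.domSer_of_isSmallSer (fun h => h0 (h ▸ Transseries.of_zero _)) hg
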